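/- **Conventions.** Let $I$ be a finite set and $W$ a Coxeter group with generators $s_i$ $(i\in I)$. Let $\mathcal H(W)$ be its Iwahori–Hecke algebra over $\mathbb Z[q^{\pm1/2}]$, with generators $T_i$ satisfying $(T_i-q)(T_i+1)=0$ and the braid relations of $W$. An $I$-labeled graph $\Lambda=(V,m,\tau)$ consists of a finite vertex set $V$, a matrix $m=(m_{uv})_{u,v\in V}$ over $\mathbb Z[q^{\pm1/2}]$ and a map $\tau$ from $V$ to the subsets of $I$. It is *reduced* if $m_{uv}=0$ whenever $\tau(u)\subseteq\tau(v)$. It is a *$W$-graph* if the free $\mathbb Z[q^{\pm1/2}]$-module on $V$ has an $\mathcal H(W)$-module structure with $$T_i(u)=\begin{cases} q\,u, & i\notin\tau(u),\\ -u+q^{1/2}\sum_{v:\,i\notin\tau(v)}m_{uv}\,v, & i\in\tau(u),\end{cases}\qquad (i\in I,\ u\in V).$$ A matrix $m$ is *strongly connected* if $V\neq\emptyset$ and the directed graph with an edge $u\to v$ whenever $m_{uv}\ne0$ is strongly connected. A *$W$-cell* is a reduced $W$-graph whose matrix $m$ is strongly connected. It is *trivial* if it has a single vertex $v$ and $\tau(v)=\emptyset$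 or $\tau(v)=I$. A *multigraph* is given by a finite vertex set $V$ and a matrix $m$ of nonnegative integers with $m_{uv}=0\iff m_{vu}=0$; there are $m_{uv}$ directed edges from $u$ to $v$. (Thus $m_{uv}=m_{vu}=1$ is a simple edge, and an edge with $m_{uv}\neq m_{vu}$ is a directed multi-edge.) If every vertex is labeled by $\{1\}$ or $\{2\}$ so that no edge joins two vertices with the same label, the multigraph is called bipartite with vertex labels $\{1\},\{2\}$; with $\tau(v)$ the label of $v$, it is a $\{1,2\}$-labeled graph with matrix of edge weights $m$. A connected multigraph with matrix $m$ is a *Dynkin diagram of finite type* if $A=2I-m$ is a Cartan matrix of finite type, that is: $A_{ii}=2$, $A_{ij}\le0$ for $i\neq j$, $A_{ij}=0\iff A_{ji}=0$, and $DA$ is symmetric and positive definite for some diagonal matrix $D$ with positive entries. Its *Coxeter number* is the order of a Coxeter element of its Weyl group: the product, in any order, of all simple reflections $s_i(\alpha_j)=\alpha_j-A_{ij}\alpha_i$, each occurring once. **Theorem 5.3 ($I_2(p)$-cells).** Let $p\ge2$ be an integer and $I_2(p)$ the dihedral group of order $2p$. Let $\Lambda$ be a bipartite strongly connected multigraph with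 vertex labels $\{1\},\{2\}$ and adjacency matrix $m$. Then $\Lambda$ is a nontrivial $I_2(p)$-cell with nonnegative edge weights $m$ if and only if it is a Dynkin diagram of finite type whose Coxeter number divides $p$. -/

import Mathlib

open scoped LaurentPolynomial

noncomputable section

namespace WGraph

/-! ### The Iwahori--Hecke algebra over `ℤ[q^{±1/2}]` -/

/-- The ground ring `ℤ[q^{±1/2}]`, as Laurent polynomials over `ℤ` in the variable `q^{1/2}`. -/
abbrev GroundRing : Type := ℤ[T;T⁻¹]

/-- The element `q^{1/2}` of the ground ring. -/
def qHalf : GroundRing := LaurentPolynomial.T 1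

/-- The element `q` of the ground ring. -/
def q : GroundRing := LaurentPolynomial.T 2

/-- The alternating product `x * y * x * ⋯` with `n` factors, beginning with `x`. -/
def altProd {A : Type*} [Monoid A] (x y : A) : ℕ → A
  | 0 => 1
  | n + 1 => x * altProd y x n

/-- The defining relations of the Iwahori--Hecke algebra of a Coxeter matrix `M`: the quadratic
relations `(T_i - q)(T_i + 1) = 0` and the braid relations `T_i T_j T_i ⋯ = T_j T_i T_j ⋯` with
`M i j` factors on each side. (The entry `0` of a Coxeter matrix stands for `∞`, and then the braid
relation below is the empty condition `1 = 1`.) -/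
inductive HeckeRel {B : Type*} (M : CoxeterMatrix B) :
    FreeAlgebra GroundRing B → FreeAlgebra GroundRing B → Prop
  | quadratic (i : B) :
      HeckeRel M
        ((FreeAlgebra.ι GroundRing i - algebraMap GroundRing (FreeAlgebra GroundRing B) q) *
          (FreeAlgebra.ι GroundRing i + 1)) 0
  | braid (i j : B) (hij : i ≠ j) :
      HeckeRel M
        (altProd (FreeAlgebra.ι GroundRing i) (FreeAlgebra.ι GroundRing j) (M i j))
        (altProd (FreeAlgebra.ι GroundRing j) (FreeAlgebra.ι GroundRing i) (M i j))

/-- The Iwahori--Hecke algebra over `ℤ[q^{±1/2}]` of the Coxeter group with Coxeter matrix `M`,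
by generators and relations. -/
abbrev HeckeAlgebra {B : Type*} (M : CoxeterMatrix B) : Type _ := RingQuot (HeckeRel M)

/-- The standard generator `T_i` of the Iwahori--Hecke algebra. -/
def heckeGen {B : Type*} (M : CoxeterMatrix B) (i : B) : HeckeAlgebra M :=
  RingQuot.mkAlgHom GroundRing (HeckeRel M) (FreeAlgebra.ι GroundRing i)

/-! ### `I`-labeled graphs, `W`-graphs and `W`-cells -/

/-- An `I`-labeled graph on the vertex set `V`: a matrix `m` of edge weights in `ℤ[q^{±1/2}]` and a
labeling `τ` of the vertices by subsets of `I`, the `τ`-invariant. -/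
structure LabeledGraph (I V : Type*) where
  /-- the matrix of edge weights -/
  m : Matrix V V GroundRing
  /-- the `τ`-invariant -/
  τ : V → Finset I

/-- A matrix, viewed as a directed graph with an edge from `u` to `v` whenever the entry at `(u, v)`
is nonzero, is strongly connected: there is at least one vertex, and every vertex can be reached
from every vertex by a directed path (possibly of length zero). -/
def StronglyConnected {V R : Type*} [Zero R] (m : Matrix V V R) : Prop :=
  Nonempty V ∧ ∀ u v : V, Relation.ReflTransGen (fun a b => m a b ≠ 0) u v

namespace LabeledGraph

variable {I V : Type*}

/-- A labeled graph is reduced if `m u v = 0` whenever `τ u ⊆ τ v`. -/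
def IsReduced (L : LabeledGraph I V) : Prop :=
  ∀ u v : V, L.τ u ⊆ L.τ v → L.m u v = 0

/-- The prescribed action of `T_i` on a vertex `u`, in the free `ℤ[q^{±1/2}]`-module on `V`:
`q u` if `i ∉ τ(u)`, and `-u + q^{1/2} ∑_{v : i ∉ τ(v)} m_{uv} v` if `i ∈ τ(u)`. -/
def action [DecidableEq I] [Fintype V] (L : LabeledGraph I V) (i : I) (u : V) :
    V →₀ GroundRing :=
  if i ∈ L.τ u then
    - Finsupp.single u 1 +
      qHalf • ∑ v with i ∉ L.τ v, L.m u v • (Finsupp.single v 1 : V →₀ GroundRing)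
  else
    q • Finsupp.single u 1

/-- An `I`-labeled graph is a `W`-graph, for the Coxeter group `W` with Coxeter matrix `M`, if the
free module on the vertices carries a module structure over the Iwahori--Hecke algebra of `W` in
which each `T_i` acts on the vertices in the prescribed way. -/
def IsWGraph [DecidableEq I] [Fintype V] (L : LabeledGraph I V) (M : CoxeterMatrix I) : Prop :=
  ∃ ρ : HeckeAlgebra M →ₐ[GroundRing] Module.End GroundRing (V →₀ GroundRing),
    ∀ (i : I) (u : V), ρ (heckeGen M i) (Finsupp.single u 1) = L.action i u

/-- A `W`-cell is a (reduced) `W`-graph whose matrix of edge weights is strongly connected. -/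
def IsWCell [DecidableEq I] [Fintype V] (L : LabeledGraph I V) (M : CoxeterMatrix I) : Prop :=
  L.IsReduced ∧ L.IsWGraph M ∧ StronglyConnected L.m

/-- A trivial cell consists of a single vertex whose `τ`-invariant is empty or all of `I`. -/
def IsTrivialCell [Fintype I] (L : LabeledGraph I V) : Prop :=
  ∃ v : V, (∀ u : V, u = v) ∧ (L.τ v = ∅ ∨ L.τ v = Finset.univ)

/-- The edge weights are nonnegative integers. -/
def HasNonnegWeights (L : LabeledGraph I V) : Prop :=
  ∀ u v : V, ∃ k : ℕ, L.m u v = k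

end LabeledGraph

/-! ### Bipartite multigraphs with vertex labels -/

/-- A multigraph on `V`, given by its adjacency matrix: there are `N u v` directed edges from `u`
to `v`, and adjacency is a symmetric relation. An undirected (simple) edge between `u` and `v` is
the case `N u v = N v u = 1`; a directed multi-edge has `N u v ≠ N v u`, both nonzero. -/
def IsMultigraph {V : Type*} (N : Matrix V V ℕ) : Prop :=
  ∀ u v : V, N u v = 0 ↔ N v u = 0

/-- The vertex coloring `c` makes `N` bipartite: no edge joins vertices of the same color. -/
def IsBipartiteColoring {V C : Type*} (N : Matrix V V ℕ) (c : V → C) : Prop :=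
  ∀ u v : V, c u = c v → N u v = 0

/-- The labeled graph with edge weights `N` in which the vertex `v` has `τ`-invariant `{c v}`. -/
def labeledGraphOf {I V : Type*} (N : Matrix V V ℕ) (c : V → I) : LabeledGraph I V where
  m := N.map (fun k : ℕ => (k : GroundRing))
  τ := fun v => {c v}

/-! ### Dynkin diagrams of finite type and their Coxeter numbers -/

section Dynkin

variable {V : Type*} [Fintype V] [DecidableEq V]

/-- The matrix `2 - N` attached to the adjacency matrix `N` of a diagram. -/
def cartanOf (N : Matrix V V ℕ) : Matrix V V ℤ := 2 - N.map (fun k : ℕ => (k : ℤ))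

/-- Generalized Cartan matrices. -/
def IsCartanMatrix (A : Matrix V V ℤ) : Prop :=
  (∀ i, A i i = 2) ∧ (∀ i j, i ≠ j → A i j ≤ 0) ∧ (∀ i j, A i j = 0 ↔ A j i = 0)

/-- A Cartan matrix is of finite type if it is symmetrizable with positive definite
symmetrization: for some diagonal matrix `D` with positive entries, `D * A` is symmetric and
positive definite. -/
def IsFiniteType (A : Matrix V V ℤ) : Prop :=
  IsCartanMatrix A ∧
    ∃ d : V → ℝ, (∀ i, 0 < d i) ∧
      (Matrix.diagonal d * A.map (fun a : ℤ => (a : ℝ))).PosDef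

/-- The diagram with adjacency matrix `N` is a (connected) Dynkin diagram of finite type: it is
connected, and `2 - N` is a Cartan matrix of finite type. -/
def IsFiniteTypeDynkinDiagram (N : Matrix V V ℕ) : Prop :=
  StronglyConnected N ∧ IsFiniteType (cartanOf N)

/-- The simple reflection `s_i` on the root lattice with basis the simple roots:
`s_i(x) = x - (A x)_i α_i`, that is, `s_i(α_j) = α_j - A i j • α_i`. -/
def simpleReflection (A : Matrix V V ℤ) (i : V) : Module.End ℤ (V → ℤ) :=
  LinearMap.id - LinearMap.single ℤ (fun _ : V => ℤ) i ∘ₗ LinearMap.proj i ∘ₗ A.mulVecLin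

/-- A Coxeter element of the Weyl group of `A`: the product of all simple reflections, each
occurring once, in some order. -/
def IsCoxeterElement (A : Matrix V V ℤ) (w : Module.End ℤ (V → ℤ)) : Prop :=
  ∃ l : List V, l.Nodup ∧ (∀ v, v ∈ l) ∧ w = (l.map (simpleReflection A)).prod

/-- `h` is the Coxeter number of `A`: the common order of the Coxeter elements. -/
def IsCoxeterNumber (A : Matrix V V ℤ) (h : ℕ) : Prop :=
  ∀ w, IsCoxeterElement A w → orderOf w = h

end Dynkin

end WGraph

end

namespace WGraph

open Polynomial

/-! Put `v = q^{1/2}`, let `x`, `y` be the matrices by which the two generators should act, and let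
`P` be the transpose of `N`. The quadratic relations are automatic, and `x + y = (v² - 1) + v P`.
Hence the defect of the braid relation of length `n + 1` satisfies the Chebyshev recurrence and
equals `(-v)ⁿ S_n(P) (x - y)` (`altProd_sub_altProd`). Up to a diagonal sign matrix, `x - y` is `v P
- (1 + v²)`.

This is read at two places. Over the ground ring the last factor can be cancelled, so the graph is a
W-graph iff `S_{p-1}(N) = 0` (`isWGraph_iff`). At `v = 1` the factor is minus the transposed Cartan
matrix, and `x`, `y` are the transposed products of the reflections of one color. If the Cartan
matrix is nonsingular, a bipartite Coxeter element `w` thus satisfies `w^p = 1` iff `S_{p-1}(N) = 0`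
(`exists_isCoxeterElement_pow_eq_one_iff`).

Two things remain. If `S_{p-1}(N) = 0`, the eigenvalues of `N` lie in `|μ| < 2`, so some positive
vector satisfies `N x < 2 x`; this makes the diagram a forest, hence symmetrizable, and a weighted
AM-GM inequality gives positive definiteness. On a forest all orderings of the reflections are
related by commutations and rotations, so all Coxeter elements have the same order. -/

theorem ringHom_map_aeval_int {A B : Type*} [Ring A] [Ring B] [Algebra ℤ A] [Algebra ℤ B]
    (f : A →+* B) (a : A) (P : ℤ[X]) : f (aeval a P) = aeval (f a) P := by
  let g : A →ₐ[ℤ] B := { f with commutes' := fun n => by simp }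
  exact (aeval_algHom_apply g a P).symm

/-! ### Braid relations and Chebyshev polynomials -/

section AltProd

variable {R A : Type*} [CommRing R] [Ring A] [Algebra R A]

theorem altProd_sub_altProd_add_two {v : R} {x y P : A}
    (hx : x * x = (v ^ 2 - 1) • x + v ^ 2 • (1 : A))
    (hy : y * y = (v ^ 2 - 1) • y + v ^ 2 • (1 : A))
    (hs : x + y = (v ^ 2 - 1) • (1 : A) + v • P) (n : ℕ) :
    altProd x y (n + 2) - altProd y x (n + 2) =
      -(v • (P * (altProd x y (n + 1) - altProd y x (n + 1)))) -
        v ^ 2 • (altProd x y n - altProd y x n) := by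
  simp only [altProd]
  generalize altProd x y n = a
  generalize altProd y x n = b
  have hP : v • P = x + y - (v ^ 2 - 1) • (1 : A) := by rw [hs]; abel
  rw [← smul_mul_assoc, hP]
  have h1 : x * (x * b) = (v ^ 2 - 1) • (x * b) + v ^ 2 • b := by
    rw [← mul_assoc, hx, add_mul, smul_mul_assoc, smul_mul_assoc, one_mul]
  have h2 : y * (y * a) = (v ^ 2 - 1) • (y * a) + v ^ 2 • a := by
    rw [← mul_assoc, hy, add_mul, smul_mul_assoc, smul_mul_assoc, one_mul]
  simp only [sub_mul, add_mul, mul_sub, h1, h2, smul_mul_assoc, one_mul, smul_sub]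
  abel

/-- The failure of the braid relation of length `n + 1` for two generators `x`, `y` satisfying the
Hecke relation is governed by a Vieta–Fibonacci polynomial in `x + y`. -/
theorem altProd_sub_altProd [Algebra ℤ A] {v : R} {x y P : A}
    (hx : x * x = (v ^ 2 - 1) • x + v ^ 2 • (1 : A))
    (hy : y * y = (v ^ 2 - 1) • y + v ^ 2 • (1 : A))
    (hs : x + y = (v ^ 2 - 1) • (1 : A) + v • P) (n : ℕ) :
    altProd x y (n + 1) - altProd y x (n + 1) =
      (-v) ^ n • (aeval P (Chebyshev.S ℤ n) * (x - y)) := by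
  induction n using Nat.twoStepInduction with
  | zero => simp [altProd]
  | one =>
    rw [altProd_sub_altProd_add_two hx hy hs]
    simp [altProd]
  | more n ih1 ih2 =>
    rw [altProd_sub_altProd_add_two hx hy hs, ih1, ih2]
    push_cast
    rw [Chebyshev.S_add_two]
    simp only [map_sub, map_mul, aeval_X, sub_mul, smul_sub, mul_smul_comm, smul_smul, mul_assoc]
    rw [← neg_smul]
    congr 2 <;> ring

theorem mul_pow_mul_altProd {M : Type*} [Monoid M] {x y : M} (hx : x * x = 1) (hy : y * y = 1)
    (n : ℕ) : (x * y) ^ n * altProd y x n = altProd x y n := by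
  induction n generalizing x y with
  | zero => simp [altProd]
  | succ n ih =>
    have h : SemiconjBy x ((y * x) ^ n) ((x * y) ^ n) :=
      SemiconjBy.pow_right (by simp [SemiconjBy, mul_assoc]) n
    calc (x * y) ^ (n + 1) * (y * altProd x y n)
        = (x * y) ^ n * x * (y * y) * altProd x y n := by simp only [pow_succ, mul_assoc]
      _ = x * ((y * x) ^ n * altProd x y n) := by rw [hy, mul_one, ← h.eq, mul_assoc]
      _ = x * altProd y x n := by rw [ih hy hx]

theorem isUnit_altProd {M : Type*} [Monoid M] {x y : M} (hx : IsUnit x) (hy : IsUnit y)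
    (n : ℕ) : IsUnit (altProd x y n) := by
  induction n generalizing x y with
  | zero => simp [altProd]
  | succ n ih => exact hx.mul (ih hy hx)

/-- Both alternating products are units, and `(x y)ⁿ` carries one to the other. -/
theorem mul_pow_eq_one_iff_altProd {M : Type*} [Monoid M] {x y : M} (hx : x * x = 1)
    (hy : y * y = 1) (n : ℕ) : (x * y) ^ n = 1 ↔ altProd x y n = altProd y x n := by
  have hu : IsUnit (altProd y x n) :=
    isUnit_altProd ⟨⟨y, y, hy, hy⟩, rfl⟩ ⟨⟨x, x, hx, hx⟩, rfl⟩ n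
  rw [← mul_pow_mul_altProd hx hy n]
  exact (hu.mul_eq_right).symm

theorem map_altProd {M M' F : Type*} [Monoid M] [Monoid M'] [FunLike F M M']
    [MonoidHomClass F M M'] (f : F) (x y : M) (n : ℕ) :
    f (altProd x y n) = altProd (f x) (f y) n := by
  induction n generalizing x y with
  | zero => simp [altProd]
  | succ n ih => simp [altProd, ih]

end AltProd

/-! ### Roots of Chebyshev polynomials and spectral radius -/

section Spectral

/-- The closed form of `S_n`, multiplied out so that it also holds at `z = ±1`. -/
theorem eval_chebyshevS_add_inv {z : ℂ} (hz : z ≠ 0) (n : ℕ) :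
    (Chebyshev.S ℂ n).eval (z + z⁻¹) * (z - z⁻¹) = z ^ (n + 1) - (z⁻¹) ^ (n + 1) := by
  induction n using Nat.twoStepInduction with
  | zero => simp
  | one => simp; ring
  | more n ih1 ih2 =>
    push_cast at ih2 ⊢
    rw [Chebyshev.S_add_two]
    simp only [eval_sub, eval_mul, eval_X]
    have : z * z⁻¹ = 1 := mul_inv_cancel₀ hz
    linear_combination (z + z⁻¹) * ih2 - ih1 + (z ^ (n + 1) - z⁻¹ ^ (n + 1)) * this

/-- The roots of the Vieta–Fibonacci polynomials have absolute value less than two. -/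
theorem norm_lt_two_of_eval_chebyshevS {μ : ℂ} {n : ℕ}
    (h : (Chebyshev.S ℂ n).eval μ = 0) : ‖μ‖ < 2 := by
  -- Writing `μ = z + z⁻¹` turns the root condition into `z^{2(n+1)} = 1`, so `|z| = 1`.
  obtain ⟨z, hz⟩ : ∃ z : ℂ, z * z - μ * z + 1 = 0 := by
    obtain ⟨z, hz⟩ := IsAlgClosed.exists_eval₂_eq_zero (RingHom.id ℂ)
      (C 1 * X ^ 2 + C (-μ) * X + C 1) (by rw [degree_quadratic one_ne_zero]; decide)
    refine ⟨z, ?_⟩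
    simp at hz
    linear_combination hz
  have hz0 : z ≠ 0 := by rintro rfl; simp at hz
  have hμ : μ = z + z⁻¹ := by
    field_simp
    linear_combination -hz
  have hpow := eval_chebyshevS_add_inv hz0 n
  rw [← hμ, h, zero_mul] at hpow
  have hz2 : z ^ (2 * (n + 1)) = 1 := by
    have : z ^ (n + 1) = (z⁻¹) ^ (n + 1) := by linear_combination -hpow
    rw [two_mul, pow_add]
    nth_rw 2 [this]
    rw [← mul_pow, mul_inv_cancel₀ hz0, one_pow]
  have hnorm : ‖z‖ = 1 := (pow_eq_one_iff_of_nonneg (norm_nonneg z) (by omega)).mp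
    (by rw [← norm_pow, hz2, norm_one] : ‖z‖ ^ (2 * (n + 1)) = 1)
  have hle : ‖μ‖ ≤ 2 := by
    rw [hμ]
    refine (norm_add_le _ _).trans ?_
    rw [norm_inv, hnorm]; norm_num
  refine lt_of_le_of_ne hle fun heq => ?_
  -- Equality in the triangle inequality forces `z = z⁻¹ = ±1`, but `S_n(±2) = (±1)ⁿ (n + 1)` is not
  -- zero.
  have hray : SameRay ℝ z z⁻¹ := by
    rw [sameRay_iff_norm_add, ← hμ, heq, norm_inv, hnorm]; norm_num
  have hzz : z = z⁻¹ := by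
    rw [sameRay_iff_of_norm_eq (by rw [norm_inv, hnorm, inv_one])] at hray
    exact hray
  have hsq : z * z = 1 := by
    nth_rw 2 [hzz]
    exact mul_inv_cancel₀ hz0
  have hn : (n : ℂ) + 1 ≠ 0 := by exact_mod_cast n.succ_ne_zero
  rcases mul_self_eq_one_iff.mp hsq with rfl | rfl
  · have : μ = 2 := by rw [hμ]; norm_num
    rw [this, Chebyshev.S_eval_two] at h
    exact hn (by exact_mod_cast h)
  · have : μ = -2 := by rw [hμ]; norm_num
    rw [this, Chebyshev.S_eval_neg_two] at h
    simp at h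
    exact hn h

/-- Gelfand's formula: `‖aᵏ‖^{1/k}` tends to the spectral radius, which is below one. -/
theorem exists_norm_pow_lt_one {A : Type*} [NormedRing A] [NormedAlgebra ℂ A] [CompleteSpace A]
    [Nontrivial A] {a : A} (h : ∀ z ∈ spectrum ℂ a, ‖z‖ < 1) :
    ∃ k : ℕ, 0 < k ∧ ‖a ^ k‖ < 1 := by
  have hr : spectralRadius ℂ a < 1 := by
    have := spectrum.spectralRadius_lt_of_forall_lt a (r := 1) (fun z hz => h z hz)
    simpa using this
  have hlim := spectrum.pow_nnnorm_pow_one_div_tendsto_nhds_spectralRadius a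
  obtain ⟨k, hk, hk0⟩ := ((hlim.eventually_lt_const hr).and (Filter.eventually_gt_atTop 0)).exists
  refine ⟨k, hk0, ?_⟩
  by_contra! hge
  refine hk.not_ge (ENNReal.one_le_rpow ?_ (by positivity))
  exact_mod_cast hge

attribute [local instance] Matrix.linftyOpNormedRing Matrix.linftyOpNormedAlgebra

/-- A nonnegative matrix annihilated by a Vieta–Fibonacci polynomial admits a positive vector that
it dilates by a factor less than two. -/
theorem exists_pos_mulVec_lt {V : Type*} [Fintype V] [DecidableEq V] [Nonempty V]
    {N : Matrix V V ℕ} {n : ℕ}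
    (h : aeval (N.map (Nat.cast : ℕ → ℤ)) (Chebyshev.S ℤ n) = 0) :
    ∃ x : V → ℝ, (∀ i, 0 < x i) ∧ ∀ i, ∑ j, (N i j : ℝ) * x j < 2 * x i := by
  set B : Matrix V V ℝ := N.map (fun k => (k : ℝ) / 2) with hB
  set M : Matrix V V ℂ := N.map (fun k => (k : ℂ) / 2) with hM
  have hMB : M = B.map (algebraMap ℝ ℂ) := by ext i j; simp [hM, hB]
  have hN : aeval (N.map (Nat.cast : ℕ → ℂ)) (Chebyshev.S ℂ n) = 0 := by
    have h1 := congrArg (Int.castRingHom ℂ).mapMatrix h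
    have h2 : (Int.castRingHom ℂ).mapMatrix (N.map (Nat.cast : ℕ → ℤ)) =
        N.map (Nat.cast : ℕ → ℂ) := by ext; simp
    rw [map_zero, ringHom_map_aeval_int, h2] at h1
    rw [← Chebyshev.map_S (Int.castRingHom ℂ), ← h1]
    exact aeval_map_algebraMap ℂ (N.map (Nat.cast : ℕ → ℂ)) (Chebyshev.S ℤ n)
  have hspec : ∀ z ∈ spectrum ℂ M, ‖z‖ < 1 := by
    intro z hz
    have h2 : (2 : ℂ) * z ∈ spectrum ℂ (N.map (Nat.cast : ℕ → ℂ)) := by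
      have : N.map (Nat.cast : ℕ → ℂ) = (Units.mk0 (2 : ℂ) two_ne_zero) • M := by
        ext i j; simp [hM, Units.smul_def]; ring
      rw [this]
      exact spectrum.smul_mem_smul_iff.mpr hz
    have h3 := spectrum.subset_polynomial_aeval _ (Chebyshev.S ℂ n) ⟨_, h2, rfl⟩
    rw [hN, spectrum.zero_eq] at h3
    have h4 := norm_lt_two_of_eval_chebyshevS h3
    rw [norm_mul, Complex.norm_ofNat] at h4
    linarith
  obtain ⟨k, hk0, hk⟩ := exists_norm_pow_lt_one hspec
  have hBnn : ∀ m i j, 0 ≤ (B ^ m) i j := by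
    intro m
    induction m with
    | zero => intro i j; simp only [pow_zero, Matrix.one_apply]; split_ifs <;> norm_num
    | succ m ih =>
      intro i j
      rw [pow_succ, Matrix.mul_apply]
      exact Finset.sum_nonneg fun l _ => mul_nonneg (ih i l) (by simp only [hB, Matrix.map_apply]; positivity)
  -- The chosen operator norm is the largest absolute row sum, and `B ^ k` is nonnegative.
  have hrow : ∀ i, ((B ^ k).mulVec 1) i < 1 := by
    intro i
    refine lt_of_le_of_lt ?_ hk
    rw [Matrix.linfty_opNorm_def, hMB, ← RingHom.mapMatrix_apply, ← map_pow]
    have h5 : ((B ^ k).mulVec 1) i =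
        ((∑ j, ‖((algebraMap ℝ ℂ).mapMatrix (B ^ k)) i j‖₊ : NNReal) : ℝ) := by
      simp only [Matrix.mulVec, dotProduct, Pi.one_apply, mul_one, NNReal.coe_sum]
      refine Finset.sum_congr rfl fun j _ => ?_
      simp [abs_of_nonneg (hBnn k i j)]
    rw [h5]
    exact_mod_cast Finset.le_sup (f := fun i => ∑ j, ‖((algebraMap ℝ ℂ).mapMatrix (B ^ k)) i j‖₊)
      (Finset.mem_univ i)
  -- With `x = ∑_{m<k} Bᵐ 1`, telescoping gives `B x = x + Bᵏ 1 - 1 < x`, and `N = 2 B`.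
  refine ⟨(∑ m ∈ Finset.range k, B ^ m).mulVec 1, fun i => ?_, fun i => ?_⟩
  · rw [Matrix.sum_mulVec, Finset.sum_apply]
    refine Finset.sum_pos' (fun m _ => ?_) ⟨0, Finset.mem_range.mpr hk0, ?_⟩
    · exact Finset.sum_nonneg fun j _ => by simpa using hBnn m i j
    · simp
  · have h6 : B * (∑ m ∈ Finset.range k, B ^ m) = (∑ m ∈ Finset.range k, B ^ m) + B ^ k - 1 := by
      rw [eq_sub_iff_add_eq, ← Finset.sum_range_succ, Finset.sum_range_succ', Finset.mul_sum]
      simp [pow_succ']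
    have h7 : ∑ j, (N i j : ℝ) * ((∑ m ∈ Finset.range k, B ^ m).mulVec 1) j =
        2 * ((B * (∑ m ∈ Finset.range k, B ^ m)).mulVec 1) i := by
      rw [← Matrix.mulVec_mulVec]
      conv_rhs => rw [Matrix.mulVec, dotProduct, Finset.mul_sum]
      refine Finset.sum_congr rfl fun j _ => ?_
      simp only [hB, Matrix.map_apply]; ring
    rw [h7, h6, Matrix.sub_mulVec, Matrix.add_mulVec]
    simp only [Pi.sub_apply, Pi.add_apply, Matrix.one_mulVec, Pi.one_apply]
    linarith [hrow i]

end Spectral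

/-! ### Words for Coxeter elements up to commutation and rotation -/

section Dynkin

variable {V : Type*}

/-- The elementary moves that relate reduced words for Coxeter elements: exchanging two adjacent
letters that commute, and a cyclic rotation. -/
inductive CoxeterMove (r : V → V → Prop) : List V → List V → Prop
  | swap (a : List V) (x y : V) (b : List V) (h : r x y) :
      CoxeterMove r (a ++ x :: y :: b) (a ++ y :: x :: b)
  | rotate (x : V) (a : List V) : CoxeterMove r (x :: a) (a ++ [x])

/-- The equivalence relation generated by Coxeter moves. -/
abbrev CoxeterEquiv (r : V → V → Prop) : List V → List V → Prop :=
  Relation.EqvGen (CoxeterMove r)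

theorem CoxeterMove.perm {r : V → V → Prop} {l l' : List V} (h : CoxeterMove r l l') :
    l.Perm l' := by
  cases h with
  | swap a x y b h => exact (List.Perm.swap y x b).append_left a
  | rotate x a => simpa using (List.perm_append_comm (l₁ := [x]) (l₂ := a))

theorem CoxeterEquiv.perm {r : V → V → Prop} {l l' : List V} (h : CoxeterEquiv r l l') :
    l.Perm l' := by
  induction h with
  | rel _ _ h => exact h.perm
  | refl _ => exact List.Perm.refl _
  | symm _ _ _ ih => exact ih.symm
  | trans _ _ _ _ _ ih1 ih2 => exact ih1.trans ih2

theorem CoxeterEquiv.append_comm (r : V → V → Prop) (a b : List V) :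
    CoxeterEquiv r (a ++ b) (b ++ a) := by
  induction a generalizing b with
  | nil => simpa using Relation.EqvGen.refl b
  | cons x a ih =>
    refine .trans _ _ _ (.rel _ _ (.rotate x (a ++ b))) ?_
    simpa using ih (b ++ [x])

theorem CoxeterEquiv.move_left {r : V → V → Prop} (a k b : List V) (v : V) (h : ∀ x ∈ k, r v x) :
    CoxeterEquiv r (a ++ v :: (k ++ b)) (a ++ (k ++ v :: b)) := by
  induction k generalizing a with
  | nil => exact .refl _
  | cons x k ih =>
    refine .trans _ _ _ (.rel _ _ (.swap a v x (k ++ b) (h x (by simp)))) ?_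
    simpa using ih (a ++ [x]) (fun y hy => h y (by simp [hy]))

/-- The only difficulty is lifting a rotation of `x :: a`. If `v` commutes with `x`, swap them and
rotate `x`. Otherwise `x = u` does not recur in `a`, so `v` commutes with all of `a`: rotate `v` to
the end, move it back through `a`, then rotate `x`. -/
theorem CoxeterEquiv.cons {r : V → V → Prop} {v u : V}
    {k k' : List V} (h : CoxeterEquiv r k k') (hk : k.Nodup)
    (hu : ∀ x ∈ k, x ≠ u → r v x) : CoxeterEquiv r (v :: k) (v :: k') := by
  induction h with
  | rel k k' h =>
    cases h with
    | swap a x y b h => exact .rel _ _ (.swap (v :: a) x y b h)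
    | rotate x a =>
      by_cases hvx : r v x
      · exact .trans _ _ _ (.rel _ _ (.swap [] v x a hvx)) (.rel _ _ (.rotate x (v :: a)))
      · have hxu : x = u := by
          by_contra hne
          exact hvx (hu x (by simp) hne)
        have ha : ∀ y ∈ a, r v y := fun y hy => by
          refine hu y (by simp [hy]) ?_
          rintro rfl
          exact (List.nodup_cons.mp hk).1 (hxu ▸ hy)
        refine .trans _ _ _ (.rel _ _ (.rotate v (x :: a))) ?_
        refine .trans _ (x :: v :: a) _ (.symm _ _ ?_) (.rel _ _ (.rotate x (v :: a)))
        simpa using CoxeterEquiv.move_left [x] a [] v ha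
  | refl _ => exact .refl _
  | symm k k' h ih =>
    have hp := CoxeterEquiv.perm h
    exact .symm _ _ (ih (hp.nodup_iff.mpr hk) fun x hx => hu x (hp.mem_iff.mp hx))
  | trans k1 k2 k3 h1 h2 ih1 ih2 =>
    have hp := CoxeterEquiv.perm h1
    exact .trans _ _ _ (ih1 hk hu)
      (ih2 (hp.nodup_iff.mp hk) fun x hx => hu x (hp.mem_iff.mpr hx))

theorem orderOf_mul_comm_of_involution {M : Type*} [Monoid M] {s k : M} (hs : s * s = 1) :
    orderOf (s * k) = orderOf (k * s) := by
  rw [orderOf_eq_orderOf_iff]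
  intro n
  have h1 : SemiconjBy s ((k * s) ^ n) ((s * k) ^ n) :=
    SemiconjBy.pow_right (by simp [SemiconjBy, mul_assoc]) n
  have h2 : SemiconjBy s ((s * k) ^ n) ((k * s) ^ n) := by
    refine SemiconjBy.pow_right ?_ n
    rw [SemiconjBy, ← mul_assoc, hs, one_mul, mul_assoc, hs, mul_one]
  constructor <;> intro h
  · rw [h, SemiconjBy, mul_one] at h2
    have := congrArg (· * s) h2
    simpa [mul_assoc, hs] using this.symm
  · rw [h, SemiconjBy, mul_one] at h1
    have := congrArg (· * s) h1
    simpa [mul_assoc, hs] using this.symm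

/-- A swap leaves the product unchanged and a rotation conjugates it by an involution. -/
theorem CoxeterEquiv.orderOf_eq {M : Type*} [Monoid M] {r : V → V → Prop} {s : V → M}
    (hs : ∀ v, s v * s v = 1) (hr : ∀ x y, r x y → s x * s y = s y * s x) {l l' : List V}
    (h : CoxeterEquiv r l l') : orderOf (l.map s).prod = orderOf (l'.map s).prod := by
  induction h with
  | rel _ _ h =>
    cases h with
    | swap a x y b h =>
      simp only [List.map_append, List.map_cons, List.prod_append, List.prod_cons]
      rw [← mul_assoc (s x), hr x y h, mul_assoc (s y)]
    | rotate x a =>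
      simp only [List.map_append, List.map_cons, List.prod_append, List.prod_cons, List.map_nil,
        List.prod_nil, mul_one]
      exact orderOf_mul_comm_of_involution (hs x)
  | refl _ => rfl
  | symm _ _ _ ih => exact ih.symm
  | trans _ _ _ _ _ ih1 ih2 => exact ih1.trans ih2

/-- A multigraph is a forest if each nonempty set `F` of vertices contains a vertex with at most
one neighbor in `F`. -/
def IsForest (N : Matrix V V ℕ) : Prop :=
  ∀ F : Finset V, F.Nonempty → ∃ v ∈ F, ∃ u : V, ∀ x ∈ F, x ≠ u → N v x = 0

/-! ### Forests: origin, symmetrizers and uniqueness of Coxeter words -/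

theorem IsForest.of_pos_vector [Fintype V] {N : Matrix V V ℕ} (hN : IsMultigraph N) {x : V → ℝ}
    (hx : ∀ i, 0 < x i) (hNx : ∀ i, ∑ j, (N i j : ℝ) * x j < 2 * x i) : IsForest N := by
  classical
  intro F hF
  by_contra! hcon
  -- Two neighbors of each vertex inside `F` make every column sum at least two. Summing `N x < 2 x`
  -- over `F` then gives a contradiction.
  have hcol : ∀ j ∈ F, (2 : ℝ) ≤ ∑ i ∈ F, (N i j : ℝ) := by
    intro j hj
    obtain ⟨a, ha, -, haj⟩ := hcon j hj j
    obtain ⟨b, hb, hba, hbj⟩ := hcon j hj a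
    have hpos : ∀ i, N j i ≠ 0 → (1 : ℝ) ≤ N i j := fun i hi => by
      exact_mod_cast Nat.one_le_iff_ne_zero.mpr fun h0 => hi ((hN i j).mp h0)
    calc (2 : ℝ) ≤ N a j + N b j := by linarith [hpos a haj, hpos b hbj]
      _ = ∑ i ∈ {a, b}, (N i j : ℝ) := by rw [Finset.sum_pair hba.symm]
      _ ≤ ∑ i ∈ F, (N i j : ℝ) := Finset.sum_le_sum_of_subset_of_nonneg
          (by simp [Finset.insert_subset_iff, ha, hb]) fun i _ _ => by positivity
  have h1 : ∑ i ∈ F, ∑ j ∈ F, (N i j : ℝ) * x j < ∑ i ∈ F, 2 * x i := by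
    refine Finset.sum_lt_sum_of_nonempty hF fun i _ => lt_of_le_of_lt ?_ (hNx i)
    exact Finset.sum_le_sum_of_subset_of_nonneg (Finset.subset_univ F)
      fun j _ _ => mul_nonneg (Nat.cast_nonneg _) (hx j).le
  have h2 : ∑ i ∈ F, 2 * x i ≤ ∑ i ∈ F, ∑ j ∈ F, (N i j : ℝ) * x j := by
    rw [Finset.sum_comm]
    refine Finset.sum_le_sum fun j hj => ?_
    rw [← Finset.sum_mul]
    exact mul_le_mul_of_nonneg_right (hcol j hj) (hx j).le
  linarith

theorem IsForest.exists_symmetrizer {N : Matrix V V ℕ} (hF : IsForest N) (hN : IsMultigraph N)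
    (F : Finset V) : ∃ d : V → ℝ, (∀ i, 0 < d i) ∧
      ∀ i ∈ F, ∀ j ∈ F, d i * (N i j : ℝ) = d j * (N j i : ℝ) := by
  classical
  induction F using Finset.strongInduction with
  | H F ih =>
    rcases F.eq_empty_or_nonempty with rfl | hne
    · exact ⟨1, by simp, by simp⟩
    obtain ⟨v, hv, u, hu⟩ := hF F hne
    obtain ⟨d, hd, hsym⟩ := ih (F.erase v) (Finset.erase_ssubset hv)
    -- The leaf `v` meets the rest of `F` at most in `u`, so its weight has a single equation to
    -- satisfy.
    obtain ⟨t, ht, htu⟩ : ∃ t : ℝ, 0 < t ∧ t * N v u = d u * N u v := by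
      by_cases h0 : N v u = 0
      · exact ⟨1, one_pos, by simp [h0, (hN v u).mp h0]⟩
      · have h1 : (0 : ℝ) < N v u := by exact_mod_cast Nat.pos_of_ne_zero h0
        have h2 : (0 : ℝ) < N u v := by
          exact_mod_cast Nat.pos_of_ne_zero fun h => h0 ((hN u v).mp h)
        exact ⟨d u * N u v / N v u, by have := hd u; positivity, by field_simp⟩
    have hvj : ∀ j ∈ F, j ≠ v → t * N v j = d j * N j v := by
      intro j hj hjv
      by_cases hju : j = u
      · rw [hju, htu]
      · have h0 := hu j hj hju
        simp [h0, (hN v j).mp h0]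
    refine ⟨Function.update d v t, fun i => ?_, fun i hi j hj => ?_⟩
    · by_cases hiv : i = v
      · simpa [hiv] using ht
      · simpa [hiv] using hd i
    · by_cases hiv : i = v <;> by_cases hjv : j = v
      · rw [hiv, hjv]
      · simpa [hiv, hjv] using hvj j hj hjv
      · simpa [hiv, hjv] using (hvj i hi hiv).symm
      · simpa [hiv, hjv] using hsym i (Finset.mem_erase.mpr ⟨hiv, hi⟩) j
          (Finset.mem_erase.mpr ⟨hjv, hj⟩)

/-- Rotate both words to begin with a leaf `v`, apply induction to the tails, and lift the result by
`CoxeterEquiv.cons`, since `v` commutes with all letters but one. -/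
theorem IsForest.coxeterEquiv {N : Matrix V V ℕ} (hF : IsForest N) {l l' : List V} (hl : l.Nodup)
    (hp : l.Perm l') : CoxeterEquiv (fun x y => N x y = 0) l l' := by
  classical
  induction hn : l.length generalizing l l' with
  | zero =>
    obtain rfl := List.length_eq_zero_iff.mp hn
    rw [List.nil_perm.mp hp]
    exact .refl _
  | succ n ih =>
    have hne : l.toFinset.Nonempty := by
      rw [List.toFinset_nonempty_iff]
      rintro rfl
      simp at hn
    obtain ⟨v, hv, u, hu⟩ := hF _ hne
    have hvl : v ∈ l := List.mem_toFinset.mp hv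
    obtain ⟨a, b, rfl⟩ := List.append_of_mem hvl
    obtain ⟨a', b', rfl⟩ := List.append_of_mem (hp.mem_iff.mp hvl)
    have h1 : CoxeterEquiv (fun x y => N x y = 0) (a ++ v :: b) (v :: (b ++ a)) :=
      CoxeterEquiv.append_comm _ a (v :: b)
    have h1' : CoxeterEquiv (fun x y => N x y = 0) (a' ++ v :: b') (v :: (b' ++ a')) :=
      CoxeterEquiv.append_comm _ a' (v :: b')
    have hnd : (v :: (b ++ a)).Nodup := (CoxeterEquiv.perm h1).nodup_iff.mp hl
    have hp2 : (b ++ a).Perm (b' ++ a') :=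
      (((CoxeterEquiv.perm h1).symm.trans hp).trans (CoxeterEquiv.perm h1')).cons_inv
    have h2 := ih (List.nodup_cons.mp hnd).2 hp2 (by simp at hn ⊢; omega)
    refine .trans _ _ _ h1 (.trans _ _ _ (CoxeterEquiv.cons (u := u) h2
      (List.nodup_cons.mp hnd).2 fun x hx => hu x ?_) (.symm _ _ h1'))
    simp at hx ⊢
    tauto

/-! ### Finite type Cartan matrices and simple reflections -/

variable [Fintype V] [DecidableEq V]

omit [Fintype V] in
theorem cartanOf_apply_self {N : Matrix V V ℕ} (hdiag : ∀ i, N i i = 0) (i : V) :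
    cartanOf N i i = 2 := by
  simp [cartanOf, hdiag, Matrix.ofNat_apply]

theorem isFiniteType_cartanOf {N : Matrix V V ℕ} (hN : IsMultigraph N) (hdiag : ∀ i, N i i = 0)
    {x : V → ℝ} (hx : ∀ i, 0 < x i) (hNx : ∀ i, ∑ j, (N i j : ℝ) * x j < 2 * x i) :
    IsFiniteType (cartanOf N) := by
  have hoff : ∀ i j, i ≠ j → cartanOf N i j = -(N i j : ℤ) := fun i j hij => by
    simp [cartanOf, Matrix.ofNat_apply, hij]
  have htwo := cartanOf_apply_self hdiag
  refine ⟨⟨htwo, fun i j hij => by simp [hoff i j hij],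
    fun i j => ?_⟩, ?_⟩
  · by_cases hij : i = j
    · rw [hij]
    · rw [hoff i j hij, hoff j i (Ne.symm hij)]
      simpa using hN i j
  obtain ⟨d, hd, hsym⟩ := (IsForest.of_pos_vector hN hx hNx).exists_symmetrizer hN Finset.univ
  refine ⟨d, hd, ?_⟩
  have hentry : ∀ i j, (Matrix.diagonal d * (cartanOf N).map (fun a : ℤ => (a : ℝ))) i j =
      (if i = j then 2 * d i else 0) - d i * N i j := by
    intro i j
    rw [Matrix.diagonal_mul]
    by_cases hij : i = j
    · subst hij; simp [htwo, hdiag]; ring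
    · simp [hoff i j hij, hij]
  refine Matrix.PosDef.of_dotProduct_mulVec_pos ?_ fun y hy => ?_
  · ext i j
    rw [Matrix.conjTranspose_apply, hentry, hentry, hsym i (by simp) j (by simp)]
    by_cases hij : i = j
    · simp [hij]
    · simp [hij, Ne.symm hij]
  have hquad : star y ⬝ᵥ (Matrix.diagonal d * (cartanOf N).map (fun a : ℤ => (a : ℝ))).mulVec y =
      ∑ i, 2 * d i * y i ^ 2 - ∑ i, ∑ j, d i * N i j * (y i * y j) := by
    simp only [dotProduct, Matrix.mulVec, hentry, sub_mul, ite_mul, zero_mul,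
      Finset.sum_sub_distrib, Finset.sum_ite_eq, Finset.mem_univ, if_true, mul_sub, Finset.mul_sum,
      Pi.star_apply, star_trivial]
    congr 1
    · exact Finset.sum_congr rfl fun i _ => by ring
    · exact Finset.sum_congr rfl fun i _ => Finset.sum_congr rfl fun j _ => by ring
  -- Weighted AM-GM, `2 y_i y_j ≤ (x_j/x_i) y_i² + (x_i/x_j) y_j²`. The symmetry of `d_i N_ij` makes
  -- the two resulting sums equal, and `N x < 2 x` bounds them.
  have hAMGM : ∑ i, ∑ j, d i * N i j * (y i * y j) ≤
      ∑ i, ∑ j, d i * N i j * (x j / x i * y i ^ 2) := by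
    have hswap : ∑ i, ∑ j, d i * N i j * (x j / x i * y i ^ 2) =
        ∑ i, ∑ j, d i * N i j * (x i / x j * y j ^ 2) := by
      rw [Finset.sum_comm]
      refine Finset.sum_congr rfl fun i _ => Finset.sum_congr rfl fun j _ => ?_
      rw [hsym i (by simp) j (by simp)]
    have h2 : 2 * ∑ i, ∑ j, d i * N i j * (y i * y j) ≤
        ∑ i, ∑ j, d i * N i j * (x j / x i * y i ^ 2) +
          ∑ i, ∑ j, d i * N i j * (x i / x j * y j ^ 2) := by
      simp only [Finset.mul_sum, ← Finset.sum_add_distrib]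
      refine Finset.sum_le_sum fun i _ => Finset.sum_le_sum fun j _ => ?_
      rw [← mul_add, mul_left_comm]
      refine mul_le_mul_of_nonneg_left ?_ (mul_nonneg (hd i).le (Nat.cast_nonneg _))
      have hi := hx i
      have hj := hx j
      have : x j / x i * y i ^ 2 + x i / x j * y j ^ 2 - 2 * (y i * y j) =
          (x j * y i - x i * y j) ^ 2 / (x i * x j) := by field_simp; ring
      have : 0 ≤ (x j * y i - x i * y j) ^ 2 / (x i * x j) := by positivity
      linarith
    rw [← hswap] at h2
    linarith
  rw [hquad]
  obtain ⟨i₀, hi₀⟩ := Function.ne_iff.mp hy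
  have hle : ∀ i, d i * y i ^ 2 / x i * ∑ j, N i j * x j ≤ 2 * d i * y i ^ 2 := fun i => by
    have hxi := hx i
    have hdi := hd i
    calc d i * y i ^ 2 / x i * ∑ j, N i j * x j ≤ d i * y i ^ 2 / x i * (2 * x i) :=
          mul_le_mul_of_nonneg_left (hNx i).le (by positivity)
      _ = 2 * d i * y i ^ 2 := by field_simp
  have hlt : d i₀ * y i₀ ^ 2 / x i₀ * ∑ j, N i₀ j * x j < 2 * d i₀ * y i₀ ^ 2 := by
    have hxi := hx i₀
    have hdi := hd i₀
    have hyi : 0 < y i₀ ^ 2 := by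
      have : y i₀ ≠ 0 := hi₀
      positivity
    calc d i₀ * y i₀ ^ 2 / x i₀ * ∑ j, N i₀ j * x j < d i₀ * y i₀ ^ 2 / x i₀ * (2 * x i₀) :=
          mul_lt_mul_of_pos_left (hNx i₀) (by positivity)
      _ = 2 * d i₀ * y i₀ ^ 2 := by field_simp
  have hfin : ∑ i, ∑ j, d i * N i j * (x j / x i * y i ^ 2) < ∑ i, 2 * d i * y i ^ 2 := by
    refine lt_of_eq_of_lt (Finset.sum_congr rfl fun i _ => ?_)
      (Finset.sum_lt_sum (fun i _ => hle i) ⟨i₀, Finset.mem_univ _, hlt⟩)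
    rw [Finset.mul_sum]
    exact Finset.sum_congr rfl fun j _ => by ring
  linarith

theorem det_ne_zero_of_isFiniteType {A : Matrix V V ℤ} (hA : IsFiniteType A) : A.det ≠ 0 := by
  obtain ⟨-, d, -, hpd⟩ := hA
  have h := hpd.det_pos.ne'
  rw [Matrix.det_mul] at h
  intro h0
  refine h (mul_eq_zero_of_right _ ?_)
  have := (Int.castRingHom ℝ).map_det A
  rw [h0, map_zero] at this
  exact this.symm

theorem simpleReflection_apply (A : Matrix V V ℤ) (i : V) (x : V → ℤ) (j : V) :
    simpleReflection A i x j = x j - if j = i then A.mulVec x i else 0 := by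
  simp [simpleReflection, Pi.single_apply]

theorem simpleReflection_mul_self {A : Matrix V V ℤ} {i : V} (h : A i i = 2) :
    simpleReflection A i * simpleReflection A i = 1 := by
  refine LinearMap.ext fun x => funext fun j => ?_
  have h1 : simpleReflection A i x = x - Pi.single i (A.mulVec x i) := by
    ext k; simp [simpleReflection_apply, Pi.single_apply]
  rw [Module.End.mul_apply, simpleReflection_apply, simpleReflection_apply]
  split_ifs with hj
  · rw [h1, Matrix.mulVec_sub]
    simp [Matrix.mulVec_single, h, hj]
    ring
  · simp

theorem simpleReflection_mul_comm {A : Matrix V V ℤ} {i j : V} (hij : A i j = 0)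
    (hji : A j i = 0) :
    simpleReflection A i * simpleReflection A j = simpleReflection A j * simpleReflection A i := by
  refine LinearMap.ext fun x => funext fun k => ?_
  have h1 : ∀ i, simpleReflection A i x = x - Pi.single i (A.mulVec x i) := fun i => by
    ext k; simp [simpleReflection_apply, Pi.single_apply]
  simp only [Module.End.mul_apply, simpleReflection_apply A _ (simpleReflection A _ x)]
  rw [simpleReflection_apply, simpleReflection_apply, h1, h1]
  simp only [Matrix.mulVec_sub, Pi.sub_apply, Matrix.mulVec_single]
  simp [hij, hji]
  ring

/-- Vertices of one color are not adjacent, so each reflection changes its own coordinate only and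
never sees the changes made by the others. -/
theorem list_prod_simpleReflection_apply {C : Type*} {N : Matrix V V ℕ} {c : V → C}
    (hbip : IsBipartiteColoring N c) {a : C} {l : List V} (hl : l.Nodup) (hc : ∀ v ∈ l, c v = a)
    (x : V → ℤ) (i : V) :
    (l.map (simpleReflection (cartanOf N))).prod x i =
      if i ∈ l then -x i + ∑ j, (N i j : ℤ) * x j else x i := by
  induction l generalizing i with
  | nil => simp
  | cons v l ih =>
    obtain ⟨hvl, hl'⟩ := List.nodup_cons.mp hl
    have ih' := ih hl' fun w hw => hc w (List.mem_cons_of_mem v hw)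
    rw [List.map_cons, List.prod_cons, Module.End.mul_apply, simpleReflection_apply, ih' i]
    set y := (l.map (simpleReflection (cartanOf N))).prod x with hy
    by_cases hiv : i = v
    · subst hiv
      have hsum : (cartanOf N).mulVec y i = 2 * x i - ∑ j, (N i j : ℤ) * x j := by
        have h1 : (cartanOf N).mulVec y i = 2 * y i - ∑ j, (N i j : ℤ) * y j := by
          rw [cartanOf, Matrix.sub_mulVec]
          simp [Matrix.mulVec, dotProduct]
        rw [h1, ih' i, if_neg hvl]
        congr 1
        refine Finset.sum_congr rfl fun j _ => ?_
        rw [ih' j]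
        split_ifs with hj
        · rw [hbip i j ((hc i (by simp)).trans (hc j (by simp [hj])).symm)]; simp
        · rfl
      rw [if_neg hvl, if_pos rfl, if_pos (by simp), hsum]
      ring
    · simp [hiv]

end Dynkin

/-! ### The generators as matrices, at `q^{1/2}` and at `1` -/

section DihedralGraph

variable {V : Type*} [Fintype V] [DecidableEq V] {R : Type*} [CommRing R]

/-- The matrix of the action of the generator `T_a` on the vertices of the labeled graph of a
bipartite multigraph, with `v` in place of `q^{1/2}`. -/
def actionMatrix (N : Matrix V V ℕ) (c : V → Fin 2) (v : R) (a : Fin 2) : Matrix V V R :=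
  Matrix.of fun i j =>
    if c j = a then v * (N j i : R) - (1 : Matrix V V R) i j else v ^ 2 * (1 : Matrix V V R) i j

theorem actionMatrix_mul_self {N : Matrix V V ℕ} {c : V → Fin 2} (hbip : IsBipartiteColoring N c)
    (v : R) (a : Fin 2) :
    actionMatrix N c v a * actionMatrix N c v a =
      (v ^ 2 - 1) • actionMatrix N c v a + v ^ 2 • (1 : Matrix V V R) := by
  ext i j
  rw [Matrix.mul_apply]
  by_cases hj : c j = a
  · have hterm : ∀ k, actionMatrix N c v a i k * actionMatrix N c v a k j =
        v ^ 3 * ((1 : Matrix V V R) i k * (N j k : R)) -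
          actionMatrix N c v a i k * (1 : Matrix V V R) k j := by
      intro k
      by_cases hk : c k = a
      · simp [actionMatrix, hj, hbip j k (hj.trans hk.symm)]
      · simp only [actionMatrix, Matrix.of_apply, if_pos hj, if_neg hk]; ring
    rw [Finset.sum_congr rfl fun k _ => hterm k, Finset.sum_sub_distrib, ← Matrix.mul_apply,
      mul_one, ← Finset.mul_sum]
    simp only [Matrix.one_apply, ite_mul, one_mul, zero_mul, Finset.sum_ite_eq, Finset.mem_univ,
      if_true, actionMatrix, Matrix.of_apply, if_pos hj, Matrix.add_apply, Matrix.smul_apply,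
      smul_eq_mul]
    ring
  · have hterm : ∀ k, actionMatrix N c v a i k * actionMatrix N c v a k j =
        v ^ 2 * (actionMatrix N c v a i k * (1 : Matrix V V R) k j) := by
      intro k
      simp only [actionMatrix, Matrix.of_apply, if_neg hj]; ring
    rw [Finset.sum_congr rfl fun k _ => hterm k, ← Finset.mul_sum, ← Matrix.mul_apply, mul_one]
    simp only [actionMatrix, Matrix.of_apply, if_neg hj, Matrix.add_apply, Matrix.smul_apply,
      smul_eq_mul]
    ring

omit [Fintype V] in
theorem actionMatrix_add (N : Matrix V V ℕ) (c : V → Fin 2) (v : R) :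
    actionMatrix N c v 0 + actionMatrix N c v 1 =
      (v ^ 2 - 1) • (1 : Matrix V V R) + v • (N.map (Nat.cast : ℕ → R)).transpose := by
  ext i j
  rcases (by omega : c j = 0 ∨ c j = 1) with h | h <;> simp [actionMatrix, h] <;> ring

theorem actionMatrix_sub (N : Matrix V V ℕ) (c : V → Fin 2) (v : R) :
    actionMatrix N c v 0 - actionMatrix N c v 1 =
      (v • (N.map (Nat.cast : ℕ → R)).transpose - (1 + v ^ 2) • (1 : Matrix V V R)) *
        Matrix.diagonal fun j => if c j = 0 then 1 else -1 := by
  ext i j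
  rw [Matrix.mul_diagonal]
  rcases (by omega : c j = 0 ∨ c j = 1) with h | h <;> simp [actionMatrix, h] <;> ring

theorem aeval_transpose (M : Matrix V V R) (P : ℤ[X]) :
    aeval M.transpose P = (aeval M P).transpose := by
  induction P using Polynomial.induction_on' with
  | add p q hp hq => simp [hp, hq]
  | monomial n a => 
    simp [aeval_monomial, Matrix.transpose_pow, (Int.cast_commute a (M.transpose ^ n)).eq]

theorem aeval_natCast_transpose (N : Matrix V V ℕ) (P : ℤ[X]) :
    aeval (N.map (Nat.cast : ℕ → R)).transpose P =
      ((aeval (N.map (Nat.cast : ℕ → ℤ)) P).map (Int.cast : ℤ → R)).transpose := by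
  rw [aeval_transpose]
  have h := ringHom_map_aeval_int (Int.castRingHom R).mapMatrix (N.map (Nat.cast : ℕ → ℤ)) P
  have h2 : (Int.castRingHom R).mapMatrix (N.map (Nat.cast : ℕ → ℤ)) =
      N.map (Nat.cast : ℕ → R) := by ext; simp
  rw [h2] at h
  rw [← h]
  rfl

/-- The braid relation of length `n + 1` for the two action matrices. -/
theorem actionMatrix_braid_iff {N : Matrix V V ℕ} {c : V → Fin 2} (hbip : IsBipartiteColoring N c)
    {v : R} (hv : IsUnit v) (n : ℕ) :
    altProd (actionMatrix N c v 0) (actionMatrix N c v 1) (n + 1) =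
        altProd (actionMatrix N c v 1) (actionMatrix N c v 0) (n + 1) ↔
      ((aeval (N.map (Nat.cast : ℕ → ℤ)) (Chebyshev.S ℤ n)).map (Int.cast : ℤ → R)).transpose *
        (v • (N.map (Nat.cast : ℕ → R)).transpose - (1 + v ^ 2) • (1 : Matrix V V R)) = 0 := by
  rw [← sub_eq_zero, altProd_sub_altProd (actionMatrix_mul_self hbip v 0)
    (actionMatrix_mul_self hbip v 1) (actionMatrix_add N c v), actionMatrix_sub,
    aeval_natCast_transpose, (hv.neg.pow n).smul_eq_zero, ← mul_assoc]
  -- The sign matrix is an involution, so it cancels on the right.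
  have hε : Matrix.diagonal (fun j => if c j = 0 then (1 : R) else -1) *
      Matrix.diagonal (fun j => if c j = 0 then (1 : R) else -1) = 1 := by
    rw [Matrix.diagonal_mul_diagonal, ← Matrix.diagonal_one]
    congr 1
    ext j
    split_ifs <;> simp
  constructor
  · intro h
    have h2 := congrArg (· * Matrix.diagonal (fun j => if c j = 0 then (1 : R) else -1)) h
    simpa only [mul_assoc, hε, mul_one, zero_mul] using h2
  · intro h
    rw [h, zero_mul]

theorem isUnit_qHalf : IsUnit qHalf := LaurentPolynomial.isUnit_T 1

theorem qHalf_sq : qHalf ^ 2 = q := by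
  rw [qHalf, q, LaurentPolynomial.T_pow]; norm_num

/-- Over the ground ring, the braid relation amounts to the vanishing of a Vieta–Fibonacci
polynomial in the adjacency matrix. -/
theorem actionMatrix_qHalf_braid_iff {N : Matrix V V ℕ} {c : V → Fin 2}
    (hbip : IsBipartiteColoring N c) (n : ℕ) :
    altProd (actionMatrix N c qHalf 0) (actionMatrix N c qHalf 1) (n + 1) =
        altProd (actionMatrix N c qHalf 1) (actionMatrix N c qHalf 0) (n + 1) ↔
      aeval (N.map (Nat.cast : ℕ → ℤ)) (Chebyshev.S ℤ n) = 0 := by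
  rw [actionMatrix_braid_iff hbip isUnit_qHalf]
  set Z := aeval (N.map (Nat.cast : ℕ → ℤ)) (Chebyshev.S ℤ n)
  constructor
  · intro h
    -- Specialize `q^{1/2}` to `1` and `-1`: adding the two identities removes the term in `N` and
    -- leaves `-4 Zᵀ = 0`.
    have hspec : ∀ u : ℤˣ, Z.transpose * ((u : ℤ) • (N.map (Nat.cast : ℕ → ℤ)).transpose -
        (1 + (u : ℤ) ^ 2) • (1 : Matrix V V ℤ)) = 0 := by
      intro u
      have h2 := congrArg (LaurentPolynomial.eval₂ (RingHom.id ℤ) u).mapMatrix h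
      rw [map_zero, map_mul] at h2
      rw [← h2]
      congr 1
      · ext i j; simp
      · ext i j
        simp only [RingHom.mapMatrix_apply, Matrix.map_apply, Matrix.sub_apply, Matrix.smul_apply,
          Matrix.transpose_apply, smul_eq_mul, map_sub, map_mul, map_add, map_pow, map_one,
          map_natCast, Matrix.one_apply, apply_ite (LaurentPolynomial.eval₂ (RingHom.id ℤ) u),
          map_zero]
        simp [qHalf]
    have h1 := hspec 1
    have h2 := hspec (-1)
    have h3 : Z.transpose = 0 := by
      have h4 : Z.transpose * ((-4 : ℤ) • (1 : Matrix V V ℤ)) = 0 := by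
        calc _ = _ := ?_
          _ = (0 : Matrix V V ℤ) + 0 := congrArg₂ (· + ·) h1 h2
          _ = 0 := add_zero 0
        rw [← mul_add]
        congr 1
        ext i j
        simp only [Matrix.add_apply, Matrix.sub_apply, Matrix.smul_apply, smul_eq_mul,
          Units.val_one, Units.val_neg]
        ring
      rw [mul_smul_comm, mul_one] at h4
      exact (smul_eq_zero.mp h4).resolve_left (by norm_num)
    simpa using h3
  · intro h
    rw [h]
    simp

/-- At `q = 1` and for an invertible Cartan matrix, the braid relation amounts to the vanishing of
the same polynomial in the adjacency matrix. -/
theorem actionMatrix_one_braid_iff {N : Matrix V V ℕ} {c : V → Fin 2}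
    (hbip : IsBipartiteColoring N c) (hdet : (cartanOf N).det ≠ 0) (n : ℕ) :
    altProd (actionMatrix N c (1 : ℤ) 0) (actionMatrix N c 1 1) (n + 1) =
        altProd (actionMatrix N c 1 1) (actionMatrix N c 1 0) (n + 1) ↔
      aeval (N.map (Nat.cast : ℕ → ℤ)) (Chebyshev.S ℤ n) = 0 := by
  rw [actionMatrix_braid_iff hbip isUnit_one]
  set Z := aeval (N.map (Nat.cast : ℕ → ℤ)) (Chebyshev.S ℤ n)
  have hA : (1 : ℤ) • (N.map (Nat.cast : ℕ → ℤ)).transpose - (1 + 1 ^ 2 : ℤ) • (1 : Matrix V V ℤ) =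
      -(cartanOf N).transpose := by
    ext i j
    simp [cartanOf, Matrix.ofNat_apply]
  have hZ : Z.map (Int.cast : ℤ → ℤ) = Z := by ext; simp
  rw [hA, hZ, mul_neg, neg_eq_zero, ← Matrix.transpose_mul, Matrix.transpose_eq_zero]
  constructor
  · intro h
    -- Multiplying by the adjugate turns the Cartan matrix into its nonzero determinant without
    -- leaving `ℤ`.
    have h2 := congrArg ((cartanOf N).adjugate * ·) h
    simp only [← mul_assoc, Matrix.adjugate_mul, mul_zero, smul_mul_assoc, one_mul] at h2
    exact (smul_eq_zero.mp h2).resolve_left hdet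
  · intro h
    rw [h, mul_zero]

/-! ### From modules and Coxeter elements to matrix identities -/

theorem action_labeledGraphOf {N : Matrix V V ℕ} {c : V → Fin 2} (hbip : IsBipartiteColoring N c)
    (a : Fin 2) (u i : V) :
    (labeledGraphOf N c).action a u i = actionMatrix N c qHalf a i u := by
  by_cases h : c u = a
  · have hsum : (∑ v with c v ≠ a, (N u v : GroundRing) • (Finsupp.single v 1 : V →₀ GroundRing)) i
        = N u i := by
      rw [Finsupp.finsetSum_apply, Finset.sum_filter]
      simp only [Finsupp.smul_apply, Finsupp.single_apply, smul_eq_mul, mul_ite, mul_one, mul_zero]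
      rw [Finset.sum_eq_single i (fun b _ hb => by simp [hb]) (by simp)]
      by_cases hi : c i = a
      · simp [hi, hbip u i (h.trans hi.symm)]
      · simp [hi]
    have ha : a ∈ (labeledGraphOf N c).τ u := by simp [labeledGraphOf, h]
    rw [LabeledGraph.action, if_pos ha, Finsupp.add_apply, Finsupp.smul_apply]
    have hfil : (∑ v with a ∉ (labeledGraphOf N c).τ v,
        (labeledGraphOf N c).m u v • (Finsupp.single v 1 : V →₀ GroundRing)) =
        ∑ v with c v ≠ a, (N u v : GroundRing) • (Finsupp.single v 1 : V →₀ GroundRing) := by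
      refine Finset.sum_congr ?_ fun v _ => rfl
      ext v
      simp [labeledGraphOf, eq_comm]
    rw [hfil, hsum]
    simp [actionMatrix, h, Finsupp.single_apply, Matrix.one_apply, eq_comm]
    ring
  · have ha : a ∉ (labeledGraphOf N c).τ u := by simpa [labeledGraphOf, eq_comm] using h
    rw [LabeledGraph.action, if_neg ha]
    simp [actionMatrix, h, qHalf_sq, Finsupp.single_apply, Matrix.one_apply, eq_comm (a := i)]

theorem forall_eq_action_iff {N : Matrix V V ℕ} {c : V → Fin 2} (hbip : IsBipartiteColoring N c)
    (a : Fin 2) (f : Module.End GroundRing (V →₀ GroundRing)) :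
    (∀ u, f (Finsupp.single u 1) = (labeledGraphOf N c).action a u) ↔
      LinearMap.toMatrixAlgEquiv (Finsupp.basisSingleOne (R := GroundRing) (ι := V)) f =
        actionMatrix N c qHalf a := by
  constructor
  · intro h
    ext1 i j
    rw [LinearMap.toMatrixAlgEquiv_apply, Finsupp.coe_basisSingleOne, h j,
      ← action_labeledGraphOf hbip]
    simp
  · intro h u
    ext1 i
    rw [action_labeledGraphOf hbip, ← h, LinearMap.toMatrixAlgEquiv_apply,
      Finsupp.coe_basisSingleOne]
    simp

/-- The quadratic relations hold for every bipartite graph, so the braid relation is the only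
condition; `CoxeterMatrix.I m` has off-diagonal entry `m + 2`. -/
theorem isWGraph_iff_altProd {N : Matrix V V ℕ} {c : V → Fin 2} (hbip : IsBipartiteColoring N c)
    (m : ℕ) :
    (labeledGraphOf N c).IsWGraph (CoxeterMatrix.I m) ↔
      altProd (actionMatrix N c qHalf 0) (actionMatrix N c qHalf 1) (m + 2) =
        altProd (actionMatrix N c qHalf 1) (actionMatrix N c qHalf 0) (m + 2) := by
  set e := LinearMap.toMatrixAlgEquiv (Finsupp.basisSingleOne (R := GroundRing) (ι := V))
  constructor
  · rintro ⟨ρ, hρ⟩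
    have he : ∀ a, e (ρ (heckeGen _ a)) = actionMatrix N c qHalf a := fun a =>
      (forall_eq_action_iff hbip a _).mp (hρ a)
    have hrel := RingQuot.mkAlgHom_rel GroundRing
      (HeckeRel.braid (M := CoxeterMatrix.I m) 0 1 (by decide))
    have h2 := congrArg (fun x => e (ρ x)) hrel
    simp only [map_altProd] at h2
    rw [← he, ← he]
    exact h2
  · intro h
    let φ : FreeAlgebra GroundRing (Fin 2) →ₐ[GroundRing] Module.End GroundRing (V →₀ GroundRing) :=
      FreeAlgebra.lift GroundRing fun a => e.symm (actionMatrix N c qHalf a)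
    have hφ : ∀ a, φ (FreeAlgebra.ι GroundRing a) = e.symm (actionMatrix N c qHalf a) := fun a => by
      simp [φ]
    have hrel : ∀ ⦃x y⦄, HeckeRel (CoxeterMatrix.I m) x y → φ x = φ y := by
      intro x y hxy
      apply e.injective
      cases hxy with
      | quadratic a =>
        simp only [map_mul, map_sub, map_add, map_one, map_zero, hφ, AlgEquiv.apply_symm_apply,
          AlgHom.commutes, AlgEquiv.commutes]
        rw [sub_mul, mul_add, actionMatrix_mul_self hbip, ← qHalf_sq, Algebra.algebraMap_eq_smul_one,
          smul_mul_assoc, one_mul, mul_one, sub_smul, one_smul, smul_add]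
        abel
      | braid a b hab =>
        simp only [map_altProd, hφ, AlgEquiv.apply_symm_apply]
        rcases (by omega : (a = 0 ∧ b = 1) ∨ (a = 1 ∧ b = 0)) with ⟨rfl, rfl⟩ | ⟨rfl, rfl⟩
        · exact h
        · exact h.symm
    refine ⟨RingQuot.liftAlgHom GroundRing ⟨φ, hrel⟩, fun a => ?_⟩
    rw [forall_eq_action_iff hbip, heckeGen, RingQuot.liftAlgHom_mkAlgHom_apply, hφ]
    exact e.apply_symm_apply _

theorem isWGraph_iff {N : Matrix V V ℕ} {c : V → Fin 2} (hbip : IsBipartiteColoring N c)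
    (m : ℕ) :
    (labeledGraphOf N c).IsWGraph (CoxeterMatrix.I m) ↔
      aeval (N.map (Nat.cast : ℕ → ℤ)) (Chebyshev.S ℤ (m + 1 : ℕ)) = 0 := by
  rw [isWGraph_iff_altProd hbip, ← actionMatrix_qHalf_braid_iff hbip]

theorem toMatrix_list_prod_simpleReflection {N : Matrix V V ℕ} {c : V → Fin 2}
    (hbip : IsBipartiteColoring N c) {a : Fin 2} {l : List V} (hl : l.Nodup)
    (hc : ∀ v, v ∈ l ↔ c v = a) :
    LinearMap.toMatrixAlgEquiv' (l.map (simpleReflection (cartanOf N))).prod =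
      (actionMatrix N c 1 a).transpose := by
  ext i j
  rw [LinearMap.toMatrixAlgEquiv'_apply,
    list_prod_simpleReflection_apply hbip hl fun v hv => (hc v).mp hv]
  by_cases h : c i = a
  · simp [actionMatrix, h, hc, Pi.single_apply, Matrix.one_apply, eq_comm]
    ring
  · simp [actionMatrix, h, hc, Pi.single_apply, Matrix.one_apply, eq_comm (a := i)]

/-- A bipartite Coxeter element detects the vanishing of Vieta–Fibonacci polynomials in the
adjacency matrix. -/
theorem exists_isCoxeterElement_pow_eq_one_iff {N : Matrix V V ℕ} {c : V → Fin 2}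
    (hbip : IsBipartiteColoring N c) (hdet : (cartanOf N).det ≠ 0) :
    ∃ w, IsCoxeterElement (cartanOf N) w ∧ ∀ n : ℕ, w ^ (n + 1) = 1 ↔
      aeval (N.map (Nat.cast : ℕ → ℤ)) (Chebyshev.S ℤ n) = 0 := by
  let l : Fin 2 → List V := fun a => (Finset.univ.filter fun v => c v = a).toList
  have hnd : ∀ a, (l a).Nodup := fun a => Finset.nodup_toList _
  have hmem : ∀ a v, v ∈ l a ↔ c v = a := fun a v => by simp [l]
  -- Color `1` precedes color `0` because transposing the product of the two action matrices
  -- reverses its order.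
  refine ⟨_, ⟨l 1 ++ l 0, ?_, fun v => ?_, rfl⟩, fun n => ?_⟩
  · refine List.nodup_append'.mpr ⟨hnd 1, hnd 0, fun v h1 h0 => ?_⟩
    rw [hmem] at h1 h0
    omega
  · rw [List.mem_append, hmem, hmem]
    omega
  · have hsq : ∀ a, actionMatrix N c (1 : ℤ) a * actionMatrix N c 1 a = 1 := fun a => by
      rw [actionMatrix_mul_self hbip]; simp
    rw [← actionMatrix_one_braid_iff hbip hdet, ← mul_pow_eq_one_iff_altProd (hsq 0) (hsq 1),
      List.map_append, List.prod_append,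
      ← (LinearMap.toMatrixAlgEquiv' (R := ℤ) (n := V)).injective.eq_iff, map_pow, map_mul, map_one,
      toMatrix_list_prod_simpleReflection hbip (hnd 1) (hmem 1),
      toMatrix_list_prod_simpleReflection hbip (hnd 0) (hmem 0), ← Matrix.transpose_mul,
      ← Matrix.transpose_pow, Matrix.transpose_eq_one]

theorem orderOf_eq_of_isCoxeterElement {N : Matrix V V ℕ} (hF : IsForest N) (hN : IsMultigraph N)
    (hdiag : ∀ i, N i i = 0) {w w' : Module.End ℤ (V → ℤ)}
    (hw : IsCoxeterElement (cartanOf N) w) (hw' : IsCoxeterElement (cartanOf N) w') :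
    orderOf w = orderOf w' := by
  obtain ⟨l, hl, hmem, rfl⟩ := hw
  obtain ⟨l', hl', hmem', rfl⟩ := hw'
  have hs : ∀ v, simpleReflection (cartanOf N) v * simpleReflection (cartanOf N) v = 1 := fun v =>
    simpleReflection_mul_self (cartanOf_apply_self hdiag v)
  refine CoxeterEquiv.orderOf_eq hs (fun x y hxy => ?_) (hF.coxeterEquiv hl
    ((List.perm_ext_iff_of_nodup hl hl').mpr fun v => by simp [hmem, hmem']))
  by_cases hxy' : x = y
  · rw [hxy']
  · exact simpleReflection_mul_comm (by simp [cartanOf, Matrix.ofNat_apply, hxy', hxy])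
      (by simp [cartanOf, Matrix.ofNat_apply, Ne.symm hxy', (hN x y).mp hxy])

end DihedralGraph

end WGraph

/-! ### The classification -/

theorem theorem5p3 {V : Type*} [Fintype V] [DecidableEq V] (p : ℕ) (hp : 2 ≤ p)
    (N : Matrix V V ℕ) (c : V → Fin 2)
    (hN : WGraph.IsMultigraph N)
    (hbip : WGraph.IsBipartiteColoring N c)
    (hconn : WGraph.StronglyConnected N) :
    ((WGraph.labeledGraphOf N c).IsWCell (CoxeterMatrix.I (p - 2)) ∧
        ¬ (WGraph.labeledGraphOf N c).IsTrivialCell ∧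
        (WGraph.labeledGraphOf N c).HasNonnegWeights) ↔
      (WGraph.IsFiniteTypeDynkinDiagram N ∧
        ∃ h : ℕ, WGraph.IsCoxeterNumber (WGraph.cartanOf N) h ∧ h ∣ p) := by
  obtain ⟨m, rfl⟩ : ∃ m, p = m + 2 := ⟨p - 2, by omega⟩
  have hdiag : ∀ i, N i i = 0 := fun i => hbip i i rfl
  have : Nonempty V := hconn.1
  rw [Nat.add_sub_cancel]
  constructor
  · rintro ⟨⟨-, hW, -⟩, -, -⟩
    rw [WGraph.isWGraph_iff hbip] at hW
    obtain ⟨x, hx, hNx⟩ := WGraph.exists_pos_mulVec_lt hW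
    have hfin := WGraph.isFiniteType_cartanOf hN hdiag hx hNx
    obtain ⟨w, hw, hpow⟩ := WGraph.exists_isCoxeterElement_pow_eq_one_iff hbip
      (WGraph.det_ne_zero_of_isFiniteType hfin)
    exact ⟨⟨hconn, hfin⟩, orderOf w, fun w' hw' => WGraph.orderOf_eq_of_isCoxeterElement
      (WGraph.IsForest.of_pos_vector hN hx hNx) hN hdiag hw' hw,
      orderOf_dvd_of_pow_eq_one ((hpow (m + 1)).mpr hW)⟩
  · rintro ⟨⟨-, hfin⟩, h, hh, hdvd⟩
    obtain ⟨w, hw, hpow⟩ := WGraph.exists_isCoxeterElement_pow_eq_one_iff hbip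
      (WGraph.det_ne_zero_of_isFiniteType hfin)
    refine ⟨⟨fun u v huv => ?_, ?_, hconn.1, fun u v => ?_⟩, ?_, fun u v => ⟨N u v, rfl⟩⟩
    · have hc : c u = c v := by simpa [WGraph.labeledGraphOf] using huv
      simp [WGraph.labeledGraphOf, hbip u v hc]
    · rw [WGraph.isWGraph_iff hbip, ← hpow]
      exact orderOf_dvd_iff_pow_eq_one.mp ((hh w hw).symm ▸ hdvd)
    · refine Relation.ReflTransGen.mono (fun a b hab => ?_) _ _ (hconn.2 u v)
      -- Evaluating at `q^{1/2} = 1` shows that a nonzero natural number stays nonzero in the ground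
      -- ring.
      intro h0
      have h1 := congrArg (LaurentPolynomial.eval₂ (RingHom.id ℤ) 1) h0
      rw [map_zero] at h1
      change LaurentPolynomial.eval₂ (RingHom.id ℤ) 1 (N a b : WGraph.GroundRing) = 0 at h1
      rw [map_natCast] at h1
      exact hab (by exact_mod_cast h1)
    · rintro ⟨v, -, h0 | h1⟩
      · simp [WGraph.labeledGraphOf] at h0
      -- In `Fin 2`, `c v + 1` is the other label.
      · have h2 : c v + 1 ∈ (WGraph.labeledGraphOf N c).τ v := h1 ▸ Finset.mem_univ _
        simp [WGraph.labeledGraphOf] at h2
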